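/- Lemma (smoothness of the discounted ASM objective). Let $\mathcal O,\mathcal A,\mathcal S$ be finite sets (observations, actions, agent states) and $\gamma\in(0,1)$. Consider an infinite-horizon non-Markovian decision process: $O_1\sim\mu$, $O_{t+1}\sim p_t(\cdot\mid O_{1:t},A_{1:t})$, with rewards $r_t(O_{1:t},A_{1:t})$, $t\ge1$, such that $|r_t(\cdot)|\le r_{\max}$ for all $t$, where $r_{\max}>0$. Let $\{\pi_\theta:\theta\in\mathbb R^d\}$ be a family of stationary agent state-Markov policies, i.e. kernels $\pi_\theta:\mathcal S\times\mathcal A\times\mathcal O\to\Delta_{\mathcal S\times\mathcal A}$ (for instance of the product form $\pi_\theta(s,a\mid\tilde s,\tilde a,o)=\nu_\theta(s\mid\tilde s,\tilde a,o)\,\phi_\theta(a\mid s)$), under which $(S_t,A_t)\sim\pi_\theta(\cdot\mid S_{t-1},A_{t-1},O_t)$ for $t\ge1$, with $(S_0,A_0)=(s_0,a_0)$ fixed. Assume that each $\pi_\theta(s,a\mid\tilde s,\tilde a,o)$ is differentiable in $\theta$ and that there are constants $G,M>0$ such that, for all $s,\tilde s\in\mathcal S$, $a,\tilde a\in\mathcal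 A$, $o\in\mathcal O$ and $\theta\in\mathbb R^d$ with $\pi_\theta(s,a\mid\tilde s,\tilde a,o)>0$, the function $\log\pi_\theta(s,a\mid\tilde s,\tilde a,o)$ is twice differentiable at $\theta$ and $$\|\nabla_\theta\log\pi_\theta(s,a\mid\tilde s,\tilde a,o)\|_2\le G,\qquad \|\nabla^2_\theta\log\pi_\theta(s,a\mid\tilde s,\tilde a,o)\|_2\le M .$$ Then the discounted objective $J_\gamma(\theta)=\mathbb E_{\pi_\theta,\mu}\big[\sum_{t=1}^\infty\gamma^{t-1}r_t(O_{1:t},A_{1:t})\big]$ is $\beta_\gamma$-smooth: it is twice differentiable on $\mathbb R^d$ and $\|\nabla^2_\theta J_\gamma(\theta)\|_2\le\beta_\gamma$ (spectral norm) for every $\theta\in\mathbb R^d$, where $$\beta_\gamma=\frac{r_{\max}}{(1-\gamma)^2}\left(M+\frac{G^2(1+\gamma)}{1-\gamma}\right).$$ -/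

import Mathlib

noncomputable section

open MeasureTheory ProbabilityTheory Finset

namespace NMDP

/-- A non-Markovian decision process with infinite horizon, observation space `O` and action
space `A`. Time is counted from `0`: index `n` here is the time step `t = n + 1` of the usual
notation, so that `Iic n → O` is the type of observation sequences up to and including that step.
Transitions and rewards depend on the whole sequence of past observations and actions. -/
structure Env (O A : Type*) where
  /-- the law of the first observation -/
  init : PMF O
  /-- the law of the next observation given all observations and actions so far -/
  trans : (n : ℕ) → (Iic n → O) → (Iic n → A) → PMF O
  /-- the reward at step `n` -/
  reward : (n : ℕ) → (Iic n → O) → (Iic n → A) → ℝ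

/-- A stationary agent state-Markov (ASM) policy, given as the combined kernel: `π s' a' o` is the
law of the new pair (agent state, action) given the previous agent state `s'`, the previous action
`a'` and the new observation `o`. A policy made of agent state dynamics `ν` and a control policy
`φ` is the case `π s' a' o (s, a) = ν s' a' o s * φ s a`. -/
abbrev Policy (O S A : Type*) := S → A → O → PMF (S × A)

section Law

variable {O S A : Type*}

/-- The law of `(O, S, A)` at a step where the observation has law `q`, the previous agent state
and action being `s` and `a`. -/
def stepPMF (π : Policy O S A) (q : PMF O) (s : S) (a : A) : PMF (O × S × A) :=
  q.bind fun o => (π s a o).map fun y => (o, y)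

variable [Finite O] [MeasurableSpace O] [MeasurableSingletonClass O]
  [Finite S] [MeasurableSpace S] [MeasurableSingletonClass S]
  [Finite A] [MeasurableSpace A] [MeasurableSingletonClass A]

/-- The conditional law of `(O, S, A)` at step `n + 1` given the trajectory up to step `n`. -/
def stepKernel (E : Env O A) (π : Policy O S A) (n : ℕ) :
    Kernel (Iic n → O × S × A) (O × S × A) :=
  Kernel.ofFunOfCountable fun h =>
    (stepPMF π (E.trans n (fun i => (h i).1) (fun i => (h i).2.2))
      (h ⟨n, mem_Iic.2 le_rfl⟩).2.1 (h ⟨n, mem_Iic.2 le_rfl⟩).2.2).toMeasure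

instance (E : Env O A) (π : Policy O S A) (n : ℕ) : IsMarkovKernel (stepKernel E π n) :=
  ⟨fun _ => PMF.toMeasure.isProbabilityMeasure _⟩

/-- The law of the infinite trajectory `(O, S, A)` at steps `0, 1, 2, …` in the environment `E`
under the policy `π`, started from the dummy agent state `s₀` and the dummy action `a₀`
(Ionescu-Tulcea). -/
def trajLaw (E : Env O A) (π : Policy O S A) (s₀ : S) (a₀ : A) : Measure (ℕ → O × S × A) :=
  Kernel.trajMeasure (X := fun _ => O × S × A) (stepPMF π E.init s₀ a₀).toMeasure (stepKernel E π)

/-- The discounted return of a trajectory. -/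
def discountedReturn (E : Env O A) (γ : ℝ) (ω : ℕ → O × S × A) : ℝ :=
  ∑' n : ℕ, γ ^ n * E.reward n (fun i => (ω i).1) (fun i => (ω i).2.2)

/-- The expected discounted return of the policy `π`. -/
def discountedValue (E : Env O A) (γ : ℝ) (s₀ : S) (a₀ : A) (π : Policy O S A) : ℝ :=
  ∫ ω, discountedReturn E γ ω ∂(trajLaw E π s₀ a₀)

end Law

section Smooth

variable {d : ℕ}

/-- The Hessian of `f` at `θ`, as a linear operator: the derivative of the gradient. Its norm as a
continuous linear map is the spectral norm of the Hessian matrix. -/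
def hessian (f : EuclideanSpace ℝ (Fin d) → ℝ) (θ : EuclideanSpace ℝ (Fin d)) :
    EuclideanSpace ℝ (Fin d) →L[ℝ] EuclideanSpace ℝ (Fin d) :=
  fderiv ℝ (gradient f) θ

/-- `f` is twice differentiable everywhere and the spectral norm of its Hessian is at most `β`. -/
def IsSmoothWith (f : EuclideanSpace ℝ (Fin d) → ℝ) (β : ℝ) : Prop :=
  Differentiable ℝ f ∧ Differentiable ℝ (gradient f) ∧ ∀ θ, ‖hessian f θ‖ ≤ β

variable {O S A : Type*}

/-- The log-probability `log π_θ(s, a ∣ s', a', o)` as a function of the parameter `θ`. -/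
def logProb (π : EuclideanSpace ℝ (Fin d) → Policy O S A) (s' : S) (a' : A) (o : O) (y : S × A)
    (θ : EuclideanSpace ℝ (Fin d)) : ℝ :=
  Real.log (π θ s' a' o y).toReal

/-- The family `π` of policies is differentiable in the parameter, the log-probabilities are
twice differentiable wherever they are finite (where the probability is positive), and there the
score has norm at most `G` and the Hessian of the log-probability has norm at most `M`. -/
structure ScoreHessianBound (π : EuclideanSpace ℝ (Fin d) → Policy O S A) (G M : ℝ) : Prop where
  differentiable : ∀ s' a' o y, Differentiable ℝ fun θ => (π θ s' a' o y).toReal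
  differentiableAt_score : ∀ s' a' o y θ, π θ s' a' o y ≠ 0 →
    DifferentiableAt ℝ (gradient (logProb π s' a' o y)) θ
  score_le : ∀ s' a' o y θ, π θ s' a' o y ≠ 0 → ‖gradient (logProb π s' a' o y) θ‖ ≤ G
  hessian_le : ∀ s' a' o y θ, π θ s' a' o y ≠ 0 → ‖hessian (logProb π s' a' o y) θ‖ ≤ M

end Smooth

end NMDP

end

open MeasureTheory ProbabilityTheory Finset

namespace NMDP

/-! ### Derivative bounds relative to the function itself -/

section Calculus

variable {V : Type*} [NormedAddCommGroup V] [NormedSpace ℝ V]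

/-! The likelihood of a trajectory segment is a product of environment factors, free of `θ`, and one
policy factor `p` per step. Since `p'' = p (∇² log p + ∇ log p ⊗ ∇ log p)`, each policy factor
satisfies `‖p'‖ ≤ G p` and `‖p''‖ ≤ (G² + M) p`. Such relative bounds pass to products
(`RelBound.mul`): `k` steps give the constants `k G` and `k² G² + k M`.

Likelihoods sum to `1`, so averaging a reward bounded by `r` against them gives a second derivative
of norm at most `r (k² G² + k M)`, however many segments there are (`RelBound.sum_mul`). With `k = n
+ 1` and weight `γ ^ n` these bounds are summable: the series can be differentiated termwise twice,
and their sum is the constant.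

The delicate point is a zero of `p`, where the assumptions on `log p` are silent. By Grönwall, a
factor that vanishes at one parameter vanishes at all of them (`eq_zero_of_norm_fderiv_le`). -/

/-- `f` is nonnegative and twice differentiable, and its first two derivatives are bounded by
`a * f` and `b * f`. -/
structure RelBound (f : V → ℝ) (a b : ℝ) : Prop where
  nonneg : ∀ x, 0 ≤ f x
  differentiable : Differentiable ℝ f
  differentiable_fderiv : Differentiable ℝ (fderiv ℝ f)
  fderiv_le : ∀ x, ‖fderiv ℝ f x‖ ≤ a * f x
  fderiv_fderiv_le : ∀ x, ‖fderiv ℝ (fderiv ℝ f) x‖ ≤ b * f x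

theorem RelBound.zero (a b : ℝ) : RelBound (fun _ : V => (0 : ℝ)) a b where
  nonneg _ := le_rfl
  differentiable := differentiable_const _
  differentiable_fderiv := by simp
  fderiv_le x := by simp
  fderiv_fderiv_le x := by
    simp only [fderiv_fun_const, Pi.zero_def, mul_zero]
    exact ContinuousLinearMap.opNorm_zero.le

/-- The second derivative of a product of scalar functions. -/
theorem hasFDerivAt_fderiv_mul {f g : V → ℝ} (hf : Differentiable ℝ f)
    (hf' : Differentiable ℝ (fderiv ℝ f)) (hg : Differentiable ℝ g)
    (hg' : Differentiable ℝ (fderiv ℝ g)) (x : V) :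
    HasFDerivAt (fderiv ℝ fun y => f y * g y)
      ((f x • fderiv ℝ (fderiv ℝ g) x + (fderiv ℝ f x).smulRight (fderiv ℝ g x)) +
        (g x • fderiv ℝ (fderiv ℝ f) x + (fderiv ℝ g x).smulRight (fderiv ℝ f x))) x := by
  have h : (fderiv ℝ fun y => f y * g y) =
      fun y => f y • fderiv ℝ g y + g y • fderiv ℝ f y := by
    ext1 y
    exact fderiv_fun_mul (hf y) (hg y)
  rw [h]
  exact ((hf x).hasFDerivAt.smul (hg' x).hasFDerivAt).add
    ((hg x).hasFDerivAt.smul (hf' x).hasFDerivAt)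

/-- Leibniz rule: relative first derivatives add, and the two cross terms of the second derivative
contribute `2 * a * a'`. -/
theorem RelBound.mul {f g : V → ℝ} {a b a' b' : ℝ} (hf : RelBound f a b) (hg : RelBound g a' b') :
    RelBound (fun x => f x * g x) (a + a') (b + 2 * a * a' + b') where
  nonneg x := mul_nonneg (hf.nonneg x) (hg.nonneg x)
  differentiable := hf.differentiable.mul hg.differentiable
  differentiable_fderiv x := (hasFDerivAt_fderiv_mul hf.differentiable hf.differentiable_fderiv
    hg.differentiable hg.differentiable_fderiv x).differentiableAt
  fderiv_le x := by
    rw [fderiv_fun_mul (hf.differentiable x) (hg.differentiable x)]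
    refine (norm_add_le _ _).trans ?_
    rw [norm_smul, norm_smul, Real.norm_of_nonneg (hf.nonneg x), Real.norm_of_nonneg (hg.nonneg x)]
    have h₁ := mul_le_mul_of_nonneg_left (hf.fderiv_le x) (hg.nonneg x)
    have h₂ := mul_le_mul_of_nonneg_left (hg.fderiv_le x) (hf.nonneg x)
    linarith
  fderiv_fderiv_le x := by
    rw [(hasFDerivAt_fderiv_mul hf.differentiable hf.differentiable_fderiv
      hg.differentiable hg.differentiable_fderiv x).fderiv]
    refine (ContinuousLinearMap.opNorm_add_le _ _).trans ((add_le_add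
      (ContinuousLinearMap.opNorm_add_le _ _) (ContinuousLinearMap.opNorm_add_le _ _)).trans ?_)
    rw [norm_smul, norm_smul, Real.norm_of_nonneg (hf.nonneg x), Real.norm_of_nonneg (hg.nonneg x),
      ContinuousLinearMap.norm_smulRight_apply, ContinuousLinearMap.norm_smulRight_apply]
    have h₁ := mul_le_mul_of_nonneg_left (hf.fderiv_fderiv_le x) (hg.nonneg x)
    have h₂ := mul_le_mul_of_nonneg_left (hg.fderiv_fderiv_le x) (hf.nonneg x)
    have h₃ := mul_le_mul (hf.fderiv_le x) (hg.fderiv_le x) (norm_nonneg _)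
      ((norm_nonneg _).trans (hf.fderiv_le x))
    linarith

theorem RelBound.const_mul {f : V → ℝ} {a b c : ℝ} (hf : RelBound f a b) (hc : 0 ≤ c) :
    RelBound (fun x => c * f x) a b := by
  have hconst : RelBound (fun _ : V => c) 0 0 :=
    { nonneg := fun _ => hc
      differentiable := differentiable_const _
      differentiable_fderiv := by simp
      fderiv_le := by simp
      fderiv_fderiv_le := fun x => by
        simp only [fderiv_fun_const, Pi.zero_def, zero_mul]
        exact ContinuousLinearMap.opNorm_zero.le }
  simpa using hconst.mul hf

/-- A linear combination of relatively bounded functions with sum `1`, with coefficients at most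
`r` in absolute value, has derivatives bounded by `r * a` and `r * b`. -/
theorem RelBound.sum_mul {ι : Type*} [Fintype ι] {f : ι → V → ℝ} {a b r : ℝ} {c : ι → ℝ}
    (hf : ∀ i, RelBound (f i) a b) (hsum : ∀ x, ∑ i, f i x = 1) (hc : ∀ i, |c i| ≤ r) :
    Differentiable ℝ (fun x => ∑ i, c i * f i x) ∧
    Differentiable ℝ (fderiv ℝ fun x => ∑ i, c i * f i x) ∧
    (∀ x, ‖fderiv ℝ (fun x => ∑ i, c i * f i x) x‖ ≤ r * a) ∧
    ∀ x, ‖fderiv ℝ (fderiv ℝ fun x => ∑ i, c i * f i x) x‖ ≤ r * b := by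
  have h₁ (x : V) : HasFDerivAt (fun x => ∑ i, c i * f i x) (∑ i, c i • fderiv ℝ (f i) x) x :=
    HasFDerivAt.fun_sum fun i _ => ((hf i).differentiable x).hasFDerivAt.const_mul (c i)
  have hfd : (fderiv ℝ fun x => ∑ i, c i * f i x) = fun x => ∑ i, c i • fderiv ℝ (f i) x :=
    funext fun x => (h₁ x).fderiv
  have h₂ (x : V) : HasFDerivAt (fderiv ℝ fun x => ∑ i, c i * f i x)
      (∑ i, c i • fderiv ℝ (fderiv ℝ (f i)) x) x := by
    rw [hfd]
    exact HasFDerivAt.fun_sum fun i _ =>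
      ((hf i).differentiable_fderiv x).hasFDerivAt.const_smul (c i)
  -- The space `W` is left free so that one estimate serves both derivatives; the weights `f i x`
  -- sum to `1`.
  have key (W : Type _) [NormedAddCommGroup W] [NormedSpace ℝ W] (D : ι → W) (x : V) (k : ℝ)
      (hD : ∀ i, ‖D i‖ ≤ k * f i x) : ‖∑ i, c i • D i‖ ≤ r * k := by
    calc ‖∑ i, c i • D i‖ ≤ ∑ i, ‖c i • D i‖ := norm_sum_le _ _
      _ ≤ ∑ i, r * (k * f i x) := sum_le_sum fun i _ => by
          rw [norm_smul]
          exact mul_le_mul (hc i) (hD i) (norm_nonneg _) ((abs_nonneg _).trans (hc i))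
      _ = r * k := by rw [← mul_sum, ← mul_sum, hsum, mul_one]
  refine ⟨fun x => (h₁ x).differentiableAt, fun x => (h₂ x).differentiableAt, fun x => ?_,
    fun x => ?_⟩
  · rw [(h₁ x).fderiv]
    exact key (V →L[ℝ] ℝ) _ x a fun i => (hf i).fderiv_le x
  · rw [(h₂ x).fderiv]
    exact key (V →L[ℝ] V →L[ℝ] ℝ) _ x b fun i => (hf i).fderiv_fderiv_le x

/-- A function whose derivative is bounded by a multiple of the function vanishes everywhere if it
vanishes at a point. -/
theorem eq_zero_of_norm_fderiv_le {f : V → ℝ} {K : ℝ} (hf : Differentiable ℝ f)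
    (hK : ∀ x, ‖fderiv ℝ f x‖ ≤ K * |f x|) {x₀ : V} (h₀ : f x₀ = 0) (x : V) : f x = 0 := by
  have hline (t : ℝ) : HasDerivAt (fun t : ℝ => f (x₀ + t • (x - x₀)))
      (fderiv ℝ f (x₀ + t • (x - x₀)) (x - x₀)) t := by
    have h : HasDerivAt (fun t : ℝ => x₀ + t • (x - x₀)) (x - x₀) t := by
      simpa using ((hasDerivAt_id t).smul_const (x - x₀)).const_add x₀
    exact (hf _).hasFDerivAt.comp_hasDerivAt t h
  -- Grönwall along the segment from `x₀` to `x`, with initial value zero.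
  have h := norm_le_gronwallBound_of_norm_deriv_right_le (δ := 0) (ε := 0) (a := 0) (b := 1)
    (K := K * ‖x - x₀‖)
    (fun t _ => (hline t).continuousAt.continuousWithinAt)
    (fun t _ => (hline t).hasDerivWithinAt) (by simp [h₀])
    (fun t _ => by
      refine ((fderiv ℝ f _).le_opNorm _).trans ?_
      have := mul_le_mul_of_nonneg_right (hK (x₀ + t • (x - x₀))) (norm_nonneg (x - x₀))
      rw [Real.norm_eq_abs]
      linarith) 1 (by simp)
  simpa [gronwallBound_ε0_δ0] using h

/-- A nonnegative differentiable function whose logarithm has bounded first and second derivatives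
wherever the function is positive is relatively bounded. -/
theorem RelBound.of_log {f : V → ℝ} {G M : ℝ} (hf0 : ∀ x, 0 ≤ f x) (hf : Differentiable ℝ f)
    (hlog : ∀ x, f x ≠ 0 → DifferentiableAt ℝ (fderiv ℝ fun y => Real.log (f y)) x)
    (hG : ∀ x, f x ≠ 0 → ‖fderiv ℝ (fun y => Real.log (f y)) x‖ ≤ G)
    (hM : ∀ x, f x ≠ 0 → ‖fderiv ℝ (fderiv ℝ fun y => Real.log (f y)) x‖ ≤ M) :
    RelBound f G (G ^ 2 + M) := by
  have hfd (x : V) (hx : f x ≠ 0) : fderiv ℝ f x = f x • fderiv ℝ (fun y => Real.log (f y)) x := by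
    rw [fderiv.log (hf x) hx, smul_smul, mul_inv_cancel₀ hx, one_smul]
  have hle (x : V) : ‖fderiv ℝ f x‖ ≤ G * f x := by
    by_cases hx : f x = 0
    -- A zero of a nonnegative function is a minimum, so the derivative vanishes there.
    · have hmin : IsLocalMin f x := Filter.Eventually.of_forall fun y => hx ▸ hf0 y
      simp [hmin.fderiv_eq_zero, hx]
    · rw [hfd x hx, norm_smul, Real.norm_of_nonneg (hf0 x), mul_comm]
      exact mul_le_mul_of_nonneg_right (hG x hx) (hf0 x)
  -- Either `f` vanishes identically, or it is positive everywhere and `f' = f • (log f)'` can be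
  -- differentiated as an identity of functions.
  by_cases h : ∃ x₀, f x₀ = 0
  · obtain ⟨x₀, h₀⟩ := h
    have : f = fun _ => 0 := funext
      (eq_zero_of_norm_fderiv_le hf (fun x => by rw [abs_of_nonneg (hf0 x)]; exact hle x) h₀)
    rw [this]
    exact RelBound.zero _ _
  · push Not at h
    have h₂ (x : V) : HasFDerivAt (fderiv ℝ f)
        (f x • fderiv ℝ (fderiv ℝ fun y => Real.log (f y)) x +
          (fderiv ℝ f x).smulRight (fderiv ℝ (fun y => Real.log (f y)) x)) x := by
      refine ((hf x).hasFDerivAt.fun_smul (hlog x (h x)).hasFDerivAt).congr_of_eventuallyEq ?_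
      exact Filter.Eventually.of_forall fun x => hfd x (h x)
    refine ⟨hf0, hf, fun x => (h₂ x).differentiableAt, hle, fun x => ?_⟩
    · rw [(h₂ x).fderiv]
      refine (ContinuousLinearMap.opNorm_add_le _ _).trans ?_
      rw [norm_smul, Real.norm_of_nonneg (hf0 x), ContinuousLinearMap.norm_smulRight_apply]
      have h₃ := mul_le_mul_of_nonneg_left (hM x (h x)) (hf0 x)
      have h₄ := mul_le_mul (hle x) (hG x (h x)) (norm_nonneg _) ((norm_nonneg _).trans (hle x))
      linarith

/-- Termwise differentiation, twice, of a series of functions. -/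
theorem tsum_twice_differentiable {f : ℕ → V → ℝ} {u v : ℕ → ℝ} {B : ℝ} (hu : Summable u)
    (hv : HasSum v B) (hf0 : ∀ x, Summable fun n => f n x) (hf : ∀ n, Differentiable ℝ (f n))
    (hf' : ∀ n, Differentiable ℝ (fderiv ℝ (f n))) (hfu : ∀ n x, ‖fderiv ℝ (f n) x‖ ≤ u n)
    (hfv : ∀ n x, ‖fderiv ℝ (fderiv ℝ (f n)) x‖ ≤ v n) :
    Differentiable ℝ (fun x => ∑' n, f n x) ∧ Differentiable ℝ (fderiv ℝ fun x => ∑' n, f n x) ∧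
    ∀ x, ‖fderiv ℝ (fderiv ℝ fun x => ∑' n, f n x) x‖ ≤ B := by
  have h₁ := fderiv_tsum hu hf hfu (hf0 0)
  have h₂ (x : V) : HasFDerivAt (fun y => ∑' n, fderiv ℝ (f n) y)
      (∑' n, fderiv ℝ (fderiv ℝ (f n)) x) x :=
    hasFDerivAt_tsum hv.summable (fun n x => (hf' n x).hasFDerivAt) hfv
      (Summable.of_norm_bounded (g := u) hu fun n => hfu n 0) x
  refine ⟨differentiable_tsum hu (fun n x => (hf n x).hasFDerivAt) hfu, ?_, fun x => ?_⟩
  · rw [h₁]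
    exact fun x => (h₂ x).differentiableAt
  · rw [h₁, (h₂ x).fderiv]
    exact tsum_of_norm_bounded (E := V →L[ℝ] V →L[ℝ] ℝ) hv fun n => hfv n x

end Calculus

/-! ### Gradients and Hessians as Fréchet derivatives -/

section Gradient

variable {d : ℕ}

theorem gradient_eq_toDual_symm_comp (f : EuclideanSpace ℝ (Fin d) → ℝ) :
    gradient f = (InnerProductSpace.toDual ℝ (EuclideanSpace ℝ (Fin d))).symm ∘ fderiv ℝ f := rfl

theorem differentiableAt_gradient_iff (f : EuclideanSpace ℝ (Fin d) → ℝ)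
    (x : EuclideanSpace ℝ (Fin d)) :
    DifferentiableAt ℝ (gradient f) x ↔ DifferentiableAt ℝ (fderiv ℝ f) x := by
  rw [gradient_eq_toDual_symm_comp]
  exact (InnerProductSpace.toDual ℝ (EuclideanSpace ℝ (Fin d))).symm.comp_differentiableAt_iff

theorem norm_gradient (f : EuclideanSpace ℝ (Fin d) → ℝ) (x : EuclideanSpace ℝ (Fin d)) :
    ‖gradient f x‖ = ‖fderiv ℝ f x‖ :=
  LinearIsometryEquiv.norm_map _ _

/-- The Riesz identification of the dual is a linear isometry, so composing with it preserves the
operator norm. -/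
theorem norm_hessian (f : EuclideanSpace ℝ (Fin d) → ℝ) (x : EuclideanSpace ℝ (Fin d)) :
    ‖hessian f x‖ = ‖fderiv ℝ (fderiv ℝ f) x‖ := by
  rw [hessian, gradient_eq_toDual_symm_comp, LinearIsometryEquiv.comp_fderiv]
  exact LinearIsometry.norm_toContinuousLinearMap_comp
    (InnerProductSpace.toDual ℝ (EuclideanSpace ℝ (Fin d))).symm.toLinearIsometry

theorem isSmoothWith_iff (f : EuclideanSpace ℝ (Fin d) → ℝ) (β : ℝ) :
    IsSmoothWith f β ↔ Differentiable ℝ f ∧ Differentiable ℝ (fderiv ℝ f) ∧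
      ∀ x, ‖fderiv ℝ (fderiv ℝ f) x‖ ≤ β := by
  simp only [IsSmoothWith, norm_hessian, Differentiable, differentiableAt_gradient_iff]

theorem ScoreHessianBound.relBound {O S A : Type*} {π : EuclideanSpace ℝ (Fin d) → Policy O S A}
    {G M : ℝ} (hπ : ScoreHessianBound π G M) (s : S) (a : A) (o : O) (y : S × A) :
    RelBound (fun θ => (π θ s a o y).toReal) G (G ^ 2 + M) := by
  have hne (θ : EuclideanSpace ℝ (Fin d)) (h : (π θ s a o y).toReal ≠ 0) : π θ s a o y ≠ 0 :=
    fun h' => h (by simp [h'])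
  refine RelBound.of_log (fun θ => ENNReal.toReal_nonneg) (hπ.differentiable s a o y)
    (fun θ h => ?_) (fun θ h => ?_) fun θ h => ?_
  · exact (differentiableAt_gradient_iff _ _).1 (hπ.differentiableAt_score s a o y θ (hne θ h))
  · exact (norm_gradient _ _).symm.trans_le (hπ.score_le s a o y θ (hne θ h))
  · exact (norm_hessian _ _).symm.trans_le (hπ.hessian_le s a o y θ (hne θ h))

end Gradient

/-- The discounted sum of the second-order bounds. -/
theorem hasSum_geometric_smoothness {γ : ℝ} (hγ0 : 0 < γ) (hγ1 : γ < 1) (r G M : ℝ) :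
    HasSum (fun n : ℕ => γ ^ n * (r * (((n : ℝ) + 1) ^ 2 * G ^ 2 + ((n : ℝ) + 1) * M)))
      (r / (1 - γ) ^ 2 * (M + G ^ 2 * (1 + γ) / (1 - γ))) := by
  have hγ : ‖γ‖ < 1 := by rwa [Real.norm_of_nonneg hγ0.le]
  have hpos : (1 - γ) ≠ 0 := by linarith
  have h₁ := hasSum_choose_mul_geometric_of_norm_lt_one 1 hγ
  have h₂ := hasSum_choose_mul_geometric_of_norm_lt_one 2 hγ
  -- From `(n + 1)² = 2 * choose (n + 2) 2 - (n + 1)`.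
  convert! (h₂.mul_left (r * (2 * G ^ 2))).add (h₁.mul_left (r * (M - G ^ 2))) using 1
  · funext n
    rw [Nat.cast_choose_two, Nat.choose_one_right]
    push_cast
    ring
  · field_simp
    ring

/-! ### Likelihoods of trajectory segments -/

section Trajectory

variable {O S A : Type*}

theorem stepPMF_apply (π : Policy O S A) (q : PMF O) (s : S) (a : A) (o : O) (y : S × A) :
    stepPMF π q s a (o, y) = q o * π s a o y := by
  classical
  rw [stepPMF, PMF.bind_apply, tsum_eq_single o]
  · rw [PMF.map_apply, tsum_eq_single y]
    · simp
    · intro y' hy'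
      simp [hy'.symm]
  · intro o' ho'
    rw [PMF.map_apply]
    simp [ho'.symm]

variable [MeasurableSpace O] [MeasurableSingletonClass O]
  [MeasurableSpace S] [MeasurableSingletonClass S] [MeasurableSpace A] [MeasurableSingletonClass A]

theorem stepPMF_toMeasure_real (π : Policy O S A) (q : PMF O) (s : S) (a : A) (z : O × S × A) :
    (stepPMF π q s a).toMeasure.real {z} = (q z.1).toReal * (π s a z.1 z.2).toReal := by
  rw [measureReal_def, PMF.toMeasure_apply_singleton _ _ (measurableSet_singleton z),
    ← ENNReal.toReal_mul, ← stepPMF_apply]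

variable [Finite O] [Finite S] [Finite A]

instance (E : Env O A) (π : Policy O S A) (s₀ : S) (a₀ : A) :
    IsProbabilityMeasure (trajLaw E π s₀ a₀) := by
  unfold trajLaw
  infer_instance

/-- The probability of the initial segment `h` of a trajectory. -/
noncomputable def segmentProb (E : Env O A) (π : Policy O S A) (s₀ : S) (a₀ : A) (n : ℕ)
    (h : Iic n → O × S × A) : ℝ :=
  ((trajLaw E π s₀ a₀).map (Preorder.frestrictLe n)).real {h}

theorem map_frestrictLe_zero_trajMeasure {X : ℕ → Type*} [∀ n, MeasurableSpace (X n)]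
    (μ : Measure (X 0)) [IsProbabilityMeasure μ]
    (κ : (n : ℕ) → Kernel (Π i : Iic n, X i) (X (n + 1))) [∀ n, IsMarkovKernel (κ n)] :
    (Kernel.trajMeasure μ κ).map (Preorder.frestrictLe 0) =
      μ.map (MeasurableEquiv.piUnique (fun i : Iic 0 => X i)).symm := by
  rw [Kernel.trajMeasure, Measure.map_comp _ _ (by fun_prop), Kernel.traj_map_frestrictLe,
    Kernel.partialTraj_self, Measure.id_comp]
  rfl

theorem segmentProb_zero (E : Env O A) (π : Policy O S A) (s₀ : S) (a₀ : A)
    (h : Iic 0 → O × S × A) :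
    segmentProb E π s₀ a₀ 0 h = (E.init (h default).1).toReal *
      (π s₀ a₀ (h default).1 (h default).2).toReal := by
  rw [segmentProb, trajLaw, map_frestrictLe_zero_trajMeasure, ← stepPMF_toMeasure_real,
    measureReal_def, MeasurableEquiv.map_apply, measureReal_def]
  congr 2
  ext z
  simp only [Set.mem_preimage, Set.mem_singleton_iff]
  exact (MeasurableEquiv.piUnique (fun i : Iic 0 => O × S × A)).symm_apply_eq

/-- The chain rule for one more step. The witnesses are chosen before `π`: the environment factor
`c` does not depend on the policy, hence not on `θ`. -/
theorem segmentProb_succ (E : Env O A) (s₀ : S) (a₀ : A) (n : ℕ)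
    (h : Iic (n + 1) → O × S × A) :
    ∃ (h' : Iic n → O × S × A) (c : ℝ) (s : S) (a : A) (z : O × S × A), 0 ≤ c ∧
      ∀ π : Policy O S A, segmentProb E π s₀ a₀ (n + 1) h =
        segmentProb E π s₀ a₀ n h' * (c * (π s a z.1 z.2).toReal) := by
  let h' : Iic n → O × S × A := Preorder.frestrictLe₂ (π := fun _ => O × S × A) n.le_succ h
  let z : O × S × A := h ⟨n + 1, mem_Iic.2 le_rfl⟩
  let last : O × S × A := h' ⟨n, mem_Iic.2 le_rfl⟩
  refine ⟨h', (E.trans n (fun i => (h' i).1) (fun i => (h' i).2.2) z.1).toReal, last.2.1,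
    last.2.2, z, ENNReal.toReal_nonneg, fun π => ?_⟩
  have hκ : (E.trans n (fun i => (h' i).1) (fun i => (h' i).2.2) z.1).toReal *
      (π last.2.1 last.2.2 z.1 z.2).toReal = (stepKernel E π n h').real {z} :=
    (stepPMF_toMeasure_real _ _ _ _ _).symm
  -- The event is a rectangle (past, next step), whose measure the composition-product computes.
  have hpre : Preorder.frestrictLe (π := fun _ => O × S × A) (n + 1) ⁻¹' {h} =
      (fun x : ℕ → O × S × A => (Preorder.frestrictLe n x, x (n + 1))) ⁻¹' ({h'} ×ˢ {z}) := by
    ext x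
    simp only [Set.mem_preimage, Set.mem_singleton_iff, Set.mem_prod]
    constructor
    · rintro rfl
      exact ⟨rfl, rfl⟩
    · rintro ⟨h₁, h₂⟩
      ext1 ⟨i, hi⟩
      obtain hi' | rfl := Nat.le_succ_iff.1 (mem_Iic.1 hi)
      · exact congrFun h₁ ⟨i, mem_Iic.2 hi'⟩
      · exact h₂
  rw [hκ, segmentProb, segmentProb, measureReal_def, measureReal_def, measureReal_def,
    Measure.map_apply (by fun_prop) (measurableSet_singleton h), hpre,
    ← Measure.map_apply (by fun_prop) (measurableSet_singleton _ |>.prod (measurableSet_singleton _)),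
    trajLaw, ← Kernel.map_frestrictLe_trajMeasure_compProd_eq_map_trajMeasure,
    Measure.compProd_apply_prod (measurableSet_singleton _) (measurableSet_singleton _),
    lintegral_singleton, ENNReal.toReal_mul, mul_comm]

theorem sum_segmentProb [Fintype O] [Fintype S] [Fintype A] (E : Env O A) (π : Policy O S A)
    (s₀ : S) (a₀ : A) (n : ℕ) : ∑ h, segmentProb E π s₀ a₀ n h = 1 := by
  have : IsProbabilityMeasure
      ((trajLaw E π s₀ a₀).map (Preorder.frestrictLe (π := fun _ => O × S × A) n)) :=
    Measure.isProbabilityMeasure_map (by fun_prop)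
  simp only [segmentProb]
  rw [sum_measureReal_singleton, coe_univ, probReal_univ]

/-- The expected discounted return is the discounted sum of the expected rewards. -/
theorem discountedValue_eq_tsum [Fintype O] [Fintype S] [Fintype A] (E : Env O A) {γ : ℝ}
    (hγ0 : 0 ≤ γ) (hγ1 : γ < 1) {r : ℝ} (hr : ∀ n o a, |E.reward n o a| ≤ r) (s₀ : S) (a₀ : A)
    (π : Policy O S A) :
    discountedValue E γ s₀ a₀ π = ∑' n : ℕ, ∑ h : Iic n → O × S × A,
      (γ ^ n * E.reward n (fun i => (h i).1) (fun i => (h i).2.2)) *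
        segmentProb E π s₀ a₀ n h := by
  let R (n : ℕ) (h : Iic n → O × S × A) : ℝ :=
    γ ^ n * E.reward n (fun i => (h i).1) (fun i => (h i).2.2)
  have hR (n : ℕ) (h) : ‖R n h‖ ≤ γ ^ n * r := by
    rw [norm_mul, Real.norm_of_nonneg (pow_nonneg hγ0 n)]
    exact mul_le_mul_of_nonneg_left (hr _ _ _) (pow_nonneg hγ0 n)
  have hmeas (n : ℕ) : Measurable fun ω : ℕ → O × S × A => R n (Preorder.frestrictLe n ω) :=
    (measurable_of_finite (R n)).comp (Preorder.measurable_frestrictLe n)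
  have hint (n : ℕ) : Integrable (fun ω : ℕ → O × S × A => R n (Preorder.frestrictLe n ω))
      (trajLaw E π s₀ a₀) :=
    Integrable.of_bound (hmeas n).aestronglyMeasurable (γ ^ n * r)
      (Filter.Eventually.of_forall fun ω => hR n _)
  have hsum : Summable fun n => ∫ ω, ‖R n (Preorder.frestrictLe n ω)‖ ∂(trajLaw E π s₀ a₀) := by
    refine Summable.of_nonneg_of_le (fun n => integral_nonneg fun ω => norm_nonneg _)
      (fun n => ?_) ((summable_geometric_of_lt_one hγ0 hγ1).mul_right r)
    refine (integral_mono (hint n).norm (integrable_const (γ ^ n * r)) fun ω => hR n _).trans ?_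
    simp
  calc discountedValue E γ s₀ a₀ π
      = ∫ ω, ∑' n, R n (Preorder.frestrictLe n ω) ∂(trajLaw E π s₀ a₀) := rfl
    _ = ∑' n, ∫ ω, R n (Preorder.frestrictLe n ω) ∂(trajLaw E π s₀ a₀) :=
        (integral_tsum_of_summable_integral_norm hint hsum).symm
    _ = _ := by
        congr 1 with n
        have hmap : ∫ h, R n h ∂((trajLaw E π s₀ a₀).map (Preorder.frestrictLe n)) =
            ∫ ω, R n (Preorder.frestrictLe n ω) ∂(trajLaw E π s₀ a₀) :=
          integral_map (by fun_prop) (measurable_of_finite (R n)).aestronglyMeasurable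
        have : IsProbabilityMeasure
            ((trajLaw E π s₀ a₀).map (Preorder.frestrictLe (π := fun _ => O × S × A) n)) :=
          Measure.isProbabilityMeasure_map (by fun_prop)
        rw [← hmap, integral_fintype .of_finite]
        exact sum_congr rfl fun h _ => mul_comm _ _

end Trajectory

/-! ### Relative bounds for the likelihoods, and the conclusion -/

section Main

variable {O S A : Type*} {d : ℕ}
  [Finite O] [MeasurableSpace O] [MeasurableSingletonClass O]
  [Finite S] [MeasurableSpace S] [MeasurableSingletonClass S]
  [Finite A] [MeasurableSpace A] [MeasurableSingletonClass A]

theorem ScoreHessianBound.relBound_segmentProb {π : EuclideanSpace ℝ (Fin d) → Policy O S A}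
    {G M : ℝ} (hπ : ScoreHessianBound π G M) (E : Env O A) (s₀ : S) (a₀ : A) (n : ℕ)
    (h : Iic n → O × S × A) :
    RelBound (fun θ => segmentProb E (π θ) s₀ a₀ n h) ((n + 1) * G)
      ((n + 1) ^ 2 * G ^ 2 + (n + 1) * M) := by
  induction n with
  -- The segment with index `0` already contains one policy factor.
  | zero =>
    simp only [segmentProb_zero]
    convert! (hπ.relBound s₀ a₀ (h default).1 (h default).2).const_mul
      (ENNReal.toReal_nonneg (a := E.init (h default).1)) using 1 <;> simp
  | succ n ih =>
    obtain ⟨h', c, s, a, z, hc, hp⟩ := segmentProb_succ E s₀ a₀ n h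
    simp only [hp]
    -- With `k = n + 1`: `k² G² + k M + 2 (k G) G + (G² + M) = (k + 1)² G² + (k + 1) M`.
    convert! (ih h').mul ((hπ.relBound s a z.1 z.2).const_mul hc) using 1 <;>
    · push_cast
      ring

end Main

end NMDP

theorem mainTheorem6 {O S A : Type*}
    [Finite O] [MeasurableSpace O] [MeasurableSingletonClass O]
    [Finite S] [MeasurableSpace S] [MeasurableSingletonClass S]
    [Finite A] [MeasurableSpace A] [MeasurableSingletonClass A]
    (E : NMDP.Env O A) (γ : ℝ) (hγ0 : 0 < γ) (hγ1 : γ < 1)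
    (rmax : ℝ) (hr0 : 0 < rmax) (hr : ∀ n o a, |E.reward n o a| ≤ rmax)
    (s₀ : S) (a₀ : A)
    (d : ℕ) (π : EuclideanSpace ℝ (Fin d) → NMDP.Policy O S A)
    (G M : ℝ) (hG : 0 < G) (hM : 0 < M) (hπ : NMDP.ScoreHessianBound π G M) :
    NMDP.IsSmoothWith (fun θ => NMDP.discountedValue E γ s₀ a₀ (π θ))
      (rmax / (1 - γ) ^ 2 * (M + G ^ 2 * (1 + γ) / (1 - γ))) := by
  have := Fintype.ofFinite O
  have := Fintype.ofFinite S
  have := Fintype.ofFinite A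
  rw [NMDP.isSmoothWith_iff]
  simp only [NMDP.discountedValue_eq_tsum E hγ0.le hγ1 hr]
  have hc (n : ℕ) (h : Finset.Iic n → O × S × A) :
      |γ ^ n * E.reward n (fun i => (h i).1) (fun i => (h i).2.2)| ≤ γ ^ n * rmax := by
    rw [abs_mul, abs_of_nonneg (pow_nonneg hγ0.le n)]
    exact mul_le_mul_of_nonneg_left (hr _ _ _) (pow_nonneg hγ0.le n)
  have key (n : ℕ) := NMDP.RelBound.sum_mul
    (fun h => hπ.relBound_segmentProb E s₀ a₀ n h)
    (fun θ => NMDP.sum_segmentProb E (π θ) s₀ a₀ n) (hc n)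
  have hu : Summable fun n : ℕ => γ ^ n * rmax * (((n : ℝ) + 1) * G) := by
    have h := (hasSum_choose_mul_geometric_of_norm_lt_one 1
      (by rwa [Real.norm_of_nonneg hγ0.le] : ‖γ‖ < 1)).summable.mul_left (rmax * G)
    convert! h using 2 with n
    rw [Nat.choose_one_right]
    push_cast
    ring
  refine NMDP.tsum_twice_differentiable hu (NMDP.hasSum_geometric_smoothness hγ0 hγ1 rmax G M)
    (fun θ => ?_) (fun n => (key n).1) (fun n => (key n).2.1) (fun n => (key n).2.2.1)
    fun n θ => ((key n).2.2.2 θ).trans_eq (mul_assoc _ _ _)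
  refine Summable.of_norm_bounded ((summable_geometric_of_lt_one hγ0.le hγ1).mul_right rmax)
    fun n => ?_
  have hp := NMDP.sum_segmentProb E (π θ) s₀ a₀ n
  refine (norm_sum_le _ _).trans ?_
  -- The factor `1` is expanded as the total likelihood, so that the sums compare term by term.
  rw [← mul_one (γ ^ n * rmax), ← hp, Finset.mul_sum]
  refine Finset.sum_le_sum fun h _ => ?_
  rw [norm_mul, Real.norm_of_nonneg ((hπ.relBound_segmentProb E s₀ a₀ n h).nonneg θ)]
  exact mul_le_mul_of_nonneg_right (hc n h) ((hπ.relBound_segmentProb E s₀ a₀ n h).nonneg θ)
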